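/- Let $d\ge 1$, $M\ge 0$ be integers, $\mathbb{T}^d=\mathbb{R}^d/\mathbb{Z}^d$, and let $F_1,\dots,F_M:\mathbb{T}^d\to\mathbb{R}$ be functions such that $F=(F_1,\dots,F_M):\mathbb{T}^d\to\mathbb{R}^M$ is a $C^2$ embedding (a $C^2$ immersion that is a homeomorphism onto its image). Put $V(x,c)=-\sum_{i=1}^M c_iF_i(x)$ for $x\in\mathbb{T}^d$, $c\in\mathbb{R}^M$. A function $\psi:\mathbb{T}^d\to\mathbb{R}$ is called semi-concave if there is a constant $C$ such that for every $x\in\mathbb{T}^d$ there is a linear form $l_x:\mathbb{R}^d\to\mathbb{R}$ with $\psi(x+v)-\psi(x)\le l_x(v)+\frac{C}{2}|v|^2$ for all $v\in\mathbb{R}^d$. If $f:\mathbb{T}^d\to\mathbb{R}$ is differentiable at $x$, its second subderivative at $x$ is $$d^2f(x)(w)=\liminf_{\tau\to0+}\frac{f(x+\tau w)-f(x)-f'(x)(\tau w)}{\frac12\tau^2}\in[-\infty,\infty],\qquad w\in\mathbb{R}^d.$$ Then $V$ is of class $C^2$, and for every $c$ the map $\frac{\partial V}{\partial c}(\cdot,c):\mathbb{T}^d\to\mathbb{R}^M$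 is a $C^2$ embedding. Moreover, there is a constant $A(F)$ depending only on $F_1,\dots,F_M$ with the following property. For every semi-concave $\psi:\mathbb{T}^d\to\mathbb{R}$ there is a positive Borel measurable function $a:\mathbb{R}^M\to\mathbb{R}$ such that, with $H(x,c)=\psi(x)+V(x,c)$: 1. for Lebesgue almost every $c\in\mathbb{R}^M$ the function $H(\cdot,c)$ has a unique minimal point $x(c)\in\mathbb{T}^d$, it is differentiable there, and $$d^2_xH(x(c),c)(v)\ge a(c)|v|^2\qquad\text{for all }v\in\mathbb{R}^d;$$ 2. let $\rho:\mathbb{R}^M\to[0,\infty)$ be any probability density with $\int|c|\rho(c)\,dc<\infty$ such that for each $1\le i\le M$ there are $\rho_i\in L^\infty(\mathbb{R})$ and $\hat\rho_i\in L^1(\mathbb{R}^{M-1})$ with $\rho(c)\le\rho_i(c_i)\,\hat\rho_i(\hat c_i)$ for almost every $c$, where $\hat c_i=(c_1,\dots,c_{i-1},c_{i+1},\dots,c_M)$. Then, for any such choice of $\rho_i,\hat\rho_i$, the function $a^{-1}\rho$ is integrable and $$\int_{\mathbb{R}^M}a(c)^{-1}\rho(c)\,dc<A(F)\sum_{i=1}^M\|\rho_i\|_{L^\infty}\|\hat\rho_i\|_{L^1}.$$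 -/

import Mathlib

open MeasureTheory Filter Topology

/-- Euclidean space `ℝᵈ`. -/
abbrev E (d : ℕ) : Type := EuclideanSpace ℝ (Fin d)

/-- The torus `𝕋ᵈ = ℝᵈ / ℤᵈ`. -/
abbrev Torus (d : ℕ) : Type := UnitAddTorus (Fin d)

/-- The projection `ℝᵈ → 𝕋ᵈ`. A function on the torus is differentiated through its
`ℤᵈ`-periodic lift to `ℝᵈ`, that is, its composition with this map. -/
def toTorus {d : ℕ} (x : E d) : Torus d := fun i => (x i : UnitAddCircle)

/-- `f` is `C`-semi-concave on the torus: every point has a linear form `l` such that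
`f y - f x ≤ l (y - x) + (C / 2) |y - x|²`, where `y = x + v` and `v` ranges over the vectors
from `x` to `y`. -/
def SemiConcaveWith {d : ℕ} (C : ℝ) (f : Torus d → ℝ) : Prop :=
  ∀ x : Torus d, ∃ l : E d →L[ℝ] ℝ, ∀ v : E d,
    f (x + toTorus v) - f x ≤ l v + C / 2 * ‖v‖ ^ 2

/-- `f` is semi-concave: `C`-semi-concave for some constant `C`. -/
def SemiConcave {d : ℕ} (f : Torus d → ℝ) : Prop := ∃ C : ℝ, SemiConcaveWith C f

/-- `Φ : 𝕋ᵈ → ℝᴹ` is a `C²` embedding: it is of class `C²`, it is a homeomorphism onto its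
image, and it is an immersion. -/
structure IsTorusEmbedding {d M : ℕ} (Φ : Torus d → E M) : Prop where
  contDiff : ContDiff ℝ 2 (fun x : E d => Φ (toTorus x))
  isEmbedding : Topology.IsEmbedding Φ
  immersion : ∀ x : E d, Function.Injective (fderiv ℝ (fun y : E d => Φ (toTorus y)) x)

/-- The map `(F₁, …, F_M) : 𝕋ᵈ → ℝᴹ`. -/
def tupleMap {d M : ℕ} (F : Fin M → Torus d → ℝ) (x : Torus d) : E M :=
  WithLp.toLp 2 (fun i => F i x)

/-- The potential `V(x, c) = - ∑ cᵢ Fᵢ(x)`. -/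
def potential {d M : ℕ} (F : Fin M → Torus d → ℝ) (x : Torus d) (c : E M) : ℝ :=
  -∑ i, c i * F i x

/-- `f : 𝕋ᵈ → ℝ` is differentiable at the point `x`. -/
def TorusDifferentiableAt {d : ℕ} (f : Torus d → ℝ) (x : Torus d) : Prop :=
  DifferentiableAt ℝ (fun v : E d => f (x + toTorus v)) 0

/-- The derivative `f'(x) : ℝᵈ → ℝ` of `f : 𝕋ᵈ → ℝ` at `x`. -/
noncomputable def torusDeriv {d : ℕ} (f : Torus d → ℝ) (x : Torus d) : E d →L[ℝ] ℝ :=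
  fderiv ℝ (fun v : E d => f (x + toTorus v)) 0

/-- The second subderivative
`d²f(x)(w) = liminf_{τ → 0+} (f(x + τ w) - f(x) - f'(x)(τ w)) / (τ² / 2)`,
with values in `[-∞, ∞]`. -/
noncomputable def secondSubderiv {d : ℕ} (f : Torus d → ℝ) (x : Torus d) (w : E d) : EReal :=
  liminf (fun τ : ℝ =>
    (((f (x + toTorus (τ • w)) - f x - torusDeriv f x (τ • w)) / (1 / 2 * τ ^ 2) : ℝ) : EReal))
    (𝓝[>] (0 : ℝ))

/-- `x` is the unique minimal point of `f` on the torus. -/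
def IsUniqueMin {d : ℕ} (f : Torus d → ℝ) (x : Torus d) : Prop :=
  ∀ y : Torus d, y ≠ x → f x < f y

/-- The minimum of `H(·, c)` is unique and nondegenerate with constant `a(c)`, for Lebesgue
almost every `c`: there is a unique minimal point `x(c)`, the function `H(·, c)` is differentiable
there, and `d²ₓH(x(c), c)(v) ≥ a(c) |v|²` for every `v`. -/
def HasNondegenerateMin {d M : ℕ} (H : Torus d → E M → ℝ) (a : E M → ℝ) : Prop :=
  ∀ᵐ c : E M, ∃ x : Torus d, IsUniqueMin (fun y => H y c) x ∧
    TorusDifferentiableAt (fun y => H y c) x ∧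
    ∀ v : E d, ((a c * ‖v‖ ^ 2 : ℝ) : EReal) ≤ secondSubderiv (fun y => H y c) x v

/-- The vector `ĉᵢ` obtained from `c` by removing the coordinate `cᵢ`. -/
def removeCoord {M : ℕ} (i : Fin M) (c : E M) : {j : Fin M // j ≠ i} → ℝ := fun j => c j

/-- `ρ` is a probability density on `ℝᴹ` with finite first moment, and for every `i` it is
dominated by `σᵢ(cᵢ) τᵢ(ĉᵢ)` with `σᵢ ∈ L^∞(ℝ)` and `τᵢ ∈ L¹(ℝ^{M-1})`. -/
structure IsDominatedDensity {M : ℕ} (ρ : E M → ℝ) (σ : Fin M → ℝ → ℝ)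
    (τ : (i : Fin M) → ({j : Fin M // j ≠ i} → ℝ) → ℝ) : Prop where
  nonneg : ∀ c, 0 ≤ ρ c
  integrable : Integrable ρ
  integral_eq_one : ∫ c, ρ c = 1
  finite_moment : Integrable (fun c : E M => ‖c‖ * ρ c)
  memLp_top : ∀ i, MemLp (σ i) ⊤
  memLp_one : ∀ i, MemLp (τ i) 1
  le_mul : ∀ i, ∀ᵐ c : E M, ρ c ≤ σ i (c i) * τ i (removeCoord i c)

/-- The number `∑ᵢ ‖σᵢ‖_{L^∞} ‖τᵢ‖_{L¹}`. -/
noncomputable def dominationBound {M : ℕ} (σ : Fin M → ℝ → ℝ)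
    (τ : (i : Fin M) → ({j : Fin M // j ≠ i} → ℝ) → ℝ) : ℝ :=
  ∑ i, (eLpNorm (σ i) ⊤ volume).toReal * (eLpNorm (τ i) 1 volume).toReal

/-! Write G(c) = max_x -(ψ(x) + V(x, c)) (`dualValue`). It is a supremum of functions affine in c,
hence convex, and F(x) is a subgradient of G at c whenever x minimizes H(·, c). Along a coordinate
line the derivative of G is therefore monotone with values in [-B, B], where B bounds all |F i|, so
its a.e. second derivative has integral at most 2B, uniformly in the line. Tonelli turns this into
a.e. finiteness and into a bound against dominated densities.

Upper curvature bounds on G are dual to lower growth bounds on H. If the second differences of G at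
c in direction i are at most K s² for small dyadic s, testing the supremum at c ± s eᵢ and nearly
optimizing s gives H(y, c) - H(x, c) ≥ (F i y - F i x)² / (8K) for F i y near F i x
(`exists_quadratic_growth`), and strict inequality whenever F i y ≠ F i x (`lt_of_apply_ne`).
Injectivity of F makes the minimizer unique. Summing over i and using the immersion constant κ
bounds the second subderivative below with a = κ / (4 M ∑ Kᵢ) (`le_secondSubderiv_minimizer`), so
a⁻¹ is a multiple of ∑ Kᵢ, whose integral is controlled. -/

/-! ### The torus and continuity of semi-concave functions. -/

theorem toTorus_add {d : ℕ} (x y : E d) : toTorus (x + y) = toTorus x + toTorus y := by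
  ext i; simp [toTorus]

theorem toTorus_zero {d : ℕ} : toTorus (0 : E d) = 0 := by
  ext i; simp [toTorus]

theorem continuous_toTorus {d : ℕ} : Continuous (toTorus : E d → Torus d) := by
  refine continuous_pi fun i => ?_
  exact (AddCircle.continuous_mk' (1 : ℝ)).comp (by fun_prop)

theorem isOpenQuotientMap_toTorus {d : ℕ} : IsOpenQuotientMap (toTorus : E d → Torus d) := by
  have h : IsOpenQuotientMap (Pi.map fun (_ : Fin d) (t : ℝ) => (t : UnitAddCircle)) :=
    IsOpenQuotientMap.piMap fun _ => QuotientAddGroup.isOpenQuotientMap_mk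
  exact h.comp (PiLp.homeomorph 2 (fun _ : Fin d => ℝ)).isOpenQuotientMap

/-- The closed unit cube, a compact set that covers the torus. -/
def unitCube (d : ℕ) : Set (E d) := {x | ∀ i, x i ∈ Set.Icc (0 : ℝ) 1}

theorem isCompact_unitCube (d : ℕ) : IsCompact (unitCube d) := by
  have h : IsCompact (Set.pi Set.univ fun _ : Fin d => Set.Icc (0 : ℝ) 1) :=
    isCompact_univ_pi fun _ => isCompact_Icc
  have h2 := (PiLp.homeomorph 2 (fun _ : Fin d => ℝ)).isCompact_preimage.2 h
  convert h2 using 1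
  ext x
  simp only [unitCube, Set.mem_preimage, Set.mem_univ_pi, Set.mem_ofPred_eq]
  rfl

theorem exists_mem_unitCube {d : ℕ} (x : Torus d) : ∃ z ∈ unitCube d, toTorus z = x := by
  have h : ∀ i, ∃ t ∈ Set.Icc (0 : ℝ) 1, (t : UnitAddCircle) = x i := fun i => by
    have := AddCircle.coe_image_Icc_eq (1 : ℝ) 0
    rw [zero_add] at this
    have hx : x i ∈ (Set.univ : Set (AddCircle (1 : ℝ))) := Set.mem_univ _
    rw [← this] at hx
    exact hx
  choose t ht hx using h
  exact ⟨WithLp.toLp 2 t, fun i => ht i, funext hx⟩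

/-- A semi-concave function on the torus is continuous: its lift differs from a concave function
on `ℝᵈ` by a quadratic one. -/
theorem SemiConcave.continuous {d : ℕ} {ψ : Torus d → ℝ} (h : SemiConcave ψ) : Continuous ψ := by
  obtain ⟨C, hC⟩ := h
  rw [isOpenQuotientMap_toTorus.isQuotientMap.continuous_iff]
  set u : E d → ℝ := fun x => ψ (toTorus x) - C / 2 * ‖x‖ ^ 2 with hu
  have key : ∀ y : E d, ∃ l : E d →L[ℝ] ℝ, ∀ z, u z ≤ u y + l (z - y) := by
    intro y
    obtain ⟨l, hl⟩ := hC (toTorus y)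
    -- Expanding |z - y|² around y moves the quadratic term into `u` and shifts the slope by C y,
    -- leaving a global supergradient.
    refine ⟨l - C • innerSL ℝ y, fun z => ?_⟩
    have h1 := hl (z - y)
    rw [← toTorus_add, add_sub_cancel] at h1
    have h2 := norm_sub_sq_real z y
    have h3 : inner ℝ y (z - y) = inner ℝ z y - ‖y‖ ^ 2 := by
      rw [inner_sub_right, real_inner_self_eq_norm_sq, real_inner_comm]
    simp only [hu, sub_apply, smul_apply, innerSL_apply_apply,
      smul_eq_mul, h3]
    rw [h2] at h1
    nlinarith
  have hconc : ConcaveOn ℝ Set.univ u := by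
    refine ⟨convex_univ, fun x _ y _ a b ha hb hab => ?_⟩
    obtain ⟨l, hl⟩ := key (a • x + b • y)
    have hx := hl x
    have hy := hl y
    have h0 : a * l (x - (a • x + b • y)) + b * l (y - (a • x + b • y)) = 0 := by
      simp only [map_sub, map_add, map_smul, smul_eq_mul]
      have : b = 1 - a := by linarith
      subst this
      ring
    have : a * u x + b * u y ≤ (a + b) * u (a • x + b • y) := by
      nlinarith [mul_le_mul_of_nonneg_left hx ha, mul_le_mul_of_nonneg_left hy hb]
    simpa [hab] using this
  have hcont : Continuous u := hconc.locallyLipschitz.continuous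
  have : ψ ∘ toTorus = fun x => u x + C / 2 * ‖x‖ ^ 2 := by
    ext x; simp [hu]
  rw [this]
  fun_prop

/-! ### Convex functions of one variable. -/

/-- If `r` is a bounded selection of the subgradient of `φ : ℝ → ℝ`, then the upper second
derivative of `φ` (along a sequence of step sizes) is bounded in `L¹` by twice the oscillation
bound of `r`. -/
theorem lintegral_limsup_second_difference_le {φ r : ℝ → ℝ} {B : ℝ}
    (hsub : ∀ t t', φ t + r t * (t' - t) ≤ φ t') (hB : ∀ t, |r t| ≤ B)
    {s : ℕ → ℝ} (hs : ∀ n, 0 < s n) (hs0 : Tendsto s atTop (𝓝 0)) :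
    ∫⁻ t, limsup (fun n => ENNReal.ofReal ((φ (t + s n) + φ (t - s n) - 2 * φ t) / s n ^ 2)) atTop
      ≤ ENNReal.ofReal (4 * B) := by
  have hmono : Monotone r := by
    intro t t' htt
    rcases htt.eq_or_lt with rfl | hlt
    · rfl
    · have h1 := hsub t t'
      have h2 := hsub t' t
      nlinarith
  set f := hmono.stieltjesFunction with hf
  have hlow : ∀ t, -B ≤ f t := fun t => by
    rw [hf, hmono.stieltjesFunction_eq]
    exact (abs_le.1 (hB t)).1.trans (hmono.le_rightLim le_rfl)
  have hupp : ∀ t, f t ≤ B := fun t => by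
    rw [hf, hmono.stieltjesFunction_eq]
    exact (hmono.rightLim_le (lt_add_one t)).trans (abs_le.1 (hB _)).2
  have htop : Tendsto f atTop (𝓝 (⨆ t, f t)) :=
    tendsto_atTop_ciSup f.mono ⟨B, by rintro _ ⟨t, rfl⟩; exact hupp t⟩
  have hbot : Tendsto f atBot (𝓝 (⨅ t, f t)) :=
    tendsto_atBot_ciInf f.mono ⟨-B, by rintro _ ⟨t, rfl⟩; exact hlow t⟩
  have hmeas : f.measure Set.univ ≤ ENNReal.ofReal (2 * B) := by
    rw [f.measure_univ hbot htop]
    refine ENNReal.ofReal_le_ofReal ?_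
    have h1 : ⨆ t, f t ≤ B := ciSup_le hupp
    have h2 : -B ≤ ⨅ t, f t := le_ciInf hlow
    linarith
  -- The subgradient inequalities at t ± s bound the second difference by s (r(t + s) - r(t - s)),
  -- and the quotient by s² tends to 2 r'(t) a.e. This 2 times the total mass 2B gives 4B.
  have hbound : ∀ᵐ t, limsup (fun n =>
      ENNReal.ofReal ((φ (t + s n) + φ (t - s n) - 2 * φ t) / s n ^ 2)) atTop
      ≤ 2 * f.measure.rnDeriv volume t := by
    filter_upwards [hmono.ae_hasDerivAt] with t ht
    set k := (f.measure.rnDeriv volume t).toReal with hk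
    have hsr : Tendsto s atTop (𝓝[≠] 0) :=
      tendsto_nhdsWithin_iff.2 ⟨hs0, Eventually.of_forall fun n => (hs n).ne'⟩
    have hsl : Tendsto (fun n => -s n) atTop (𝓝[≠] 0) :=
      tendsto_nhdsWithin_iff.2 ⟨by simpa using hs0.neg,
        Eventually.of_forall fun n => (neg_neg_of_pos (hs n)).ne⟩
    have h1 := ht.tendsto_slope_zero.comp hsr
    have h2 := ht.tendsto_slope_zero.comp hsl
    have h3 := ENNReal.tendsto_ofReal (h1.add h2)
    calc _ ≤ limsup (fun n => ENNReal.ofReal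
          (((fun t_1 => t_1⁻¹ • (r (t + t_1) - r t)) ∘ s) n +
            ((fun t_1 => t_1⁻¹ • (r (t + t_1) - r t)) ∘ fun n => -s n) n)) atTop := by
          refine limsup_le_limsup (Eventually.of_forall fun n => ENNReal.ofReal_le_ofReal ?_)
          have hn := hs n
          have e1 := hsub (t + s n) t
          have e2 := hsub (t - s n) t
          simp only [Function.comp, smul_eq_mul, ← sub_eq_add_neg]
          have : (s n)⁻¹ * (r (t + s n) - r t) + (-s n)⁻¹ * (r (t - s n) - r t)
              = (s n * (r (t + s n) - r (t - s n))) / s n ^ 2 := by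
            field_simp
            ring
          rw [this]
          gcongr
          nlinarith
      _ = ENNReal.ofReal (k + k) := h3.limsup_eq
      _ ≤ 2 * f.measure.rnDeriv volume t := by
          rw [ENNReal.ofReal_add ENNReal.toReal_nonneg ENNReal.toReal_nonneg, two_mul]
          exact add_le_add ENNReal.ofReal_toReal_le ENNReal.ofReal_toReal_le
  calc _ ≤ ∫⁻ t, 2 * f.measure.rnDeriv volume t := lintegral_mono_ae hbound
    _ = 2 * ∫⁻ t, f.measure.rnDeriv volume t := lintegral_const_mul _ (Measure.measurable_rnDeriv _ _)
    _ ≤ 2 * ENNReal.ofReal (2 * B) := by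
        gcongr
        exact Measure.lintegral_rnDeriv_le.trans hmeas
    _ = ENNReal.ofReal (4 * B) := by
        rw [show (2 : ENNReal) = ENNReal.ofReal 2 by simp, ← ENNReal.ofReal_mul (by norm_num)]
        congr 1; ring

/-! ### Integration along coordinate lines. -/

/-- The measurable splitting `c ↦ (cᵢ, ĉᵢ)`. -/
noncomputable def splitCoord {M : ℕ} (i : Fin M) : E M ≃ᵐ ℝ × ({j : Fin M // j ≠ i} → ℝ) :=
  ((MeasurableEquiv.toLp 2 (Fin M → ℝ)).symm.trans
    (MeasurableEquiv.piEquivPiSubtypeProd (fun _ : Fin M => ℝ) (fun j => j = i))).trans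
    (MeasurableEquiv.prodCongr (MeasurableEquiv.funUnique {j : Fin M // j = i} ℝ)
      (MeasurableEquiv.refl _))

theorem splitCoord_apply {M : ℕ} (i : Fin M) (c : E M) : splitCoord i c = (c i, removeCoord i c) :=
  rfl

theorem measurePreserving_splitCoord {M : ℕ} (i : Fin M) : MeasurePreserving (splitCoord i) := by
  have h1 : MeasurePreserving (MeasurableEquiv.toLp 2 (Fin M → ℝ)).symm :=
    PiLp.volume_preserving_ofLp (Fin M)
  have h2 : MeasurePreserving
      (MeasurableEquiv.piEquivPiSubtypeProd (fun _ : Fin M => ℝ) (fun j => j = i)) volume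
      ((volume : Measure ({j : Fin M // j = i} → ℝ)).prod
        (volume : Measure ({j : Fin M // j ≠ i} → ℝ))) := by
    simp only [volume_pi]
    convert measurePreserving_piEquivPiSubtypeProd (fun _ : Fin M => (volume : Measure ℝ))
      (fun j => j = i) <;> rfl
  have h0 : MeasurePreserving (MeasurableEquiv.funUnique {j : Fin M // j = i} ℝ) := by
    convert volume_preserving_funUnique {j : Fin M // j = i} ℝ <;> rfl
  have h3 := h0.prod (MeasurePreserving.id (volume : Measure ({j : Fin M // j ≠ i} → ℝ)))
  exact h3.comp (h2.comp h1)

theorem splitCoord_symm_add {M : ℕ} (i : Fin M) (t : ℝ) (w : {j : Fin M // j ≠ i} → ℝ) :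
    (splitCoord i).symm (t, w) = (splitCoord i).symm (0, w) + EuclideanSpace.single i t := by
  apply (splitCoord i).injective
  rw [MeasurableEquiv.apply_symm_apply, splitCoord_apply]
  have h := (splitCoord i).apply_symm_apply (0, w)
  rw [splitCoord_apply, Prod.mk.injEq] at h
  ext j
  · simp [h.1]
  · have := congrFun h.2 j
    simp only [removeCoord] at this
    simp [removeCoord, this, j.2]

/-- Tonelli: the weight is constant on each line in direction i, so the uniform line bound factors
out. -/
theorem lintegral_mul_removeCoord_le {M : ℕ} (i : Fin M) {L : E M → ENNReal} (hL : Measurable L)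
    {C : ENNReal} (hline : ∀ c, ∫⁻ t, L (c + EuclideanSpace.single i t) ≤ C)
    {q : ({j : Fin M // j ≠ i} → ℝ) → ENNReal} (hq : AEMeasurable q) :
    ∫⁻ c, L c * q (removeCoord i c) ≤ C * ∫⁻ w, q w := by
  have hmp := (measurePreserving_splitCoord i).symm
  rw [← hmp.lintegral_comp_emb (splitCoord i).symm.measurableEmbedding]
  have e : ∀ p : ℝ × ({j : Fin M // j ≠ i} → ℝ),
      L ((splitCoord i).symm p) * q (removeCoord i ((splitCoord i).symm p))
        = L ((splitCoord i).symm p) * q p.2 := fun p => by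
    have h := (splitCoord i).apply_symm_apply p
    rw [splitCoord_apply] at h
    rw [show removeCoord i ((splitCoord i).symm p) = p.2 from congrArg Prod.snd h]
  simp_rw [e]
  have hLm : Measurable fun p : ℝ × ({j : Fin M // j ≠ i} → ℝ) => L ((splitCoord i).symm p) :=
    hL.comp (splitCoord i).symm.measurable
  have hqm : AEMeasurable (fun p : ℝ × ({j : Fin M // j ≠ i} → ℝ) => q p.2)
      ((volume : Measure ℝ).prod volume) :=
    hq.comp_quasiMeasurePreserving Measure.quasiMeasurePreserving_snd
  rw [Measure.volume_eq_prod, lintegral_prod_symm (fun p => L ((splitCoord i).symm p) * q p.2)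
      (hLm.aemeasurable.mul hqm),
    ← lintegral_const_mul'' _ hq]
  refine lintegral_mono fun w => ?_
  have hw : Measurable fun t : ℝ => L ((splitCoord i).symm (t, w)) :=
    hLm.comp (measurable_id.prodMk measurable_const)
  change ∫⁻ t, L ((splitCoord i).symm (t, w)) * q w ≤ C * q w
  rw [lintegral_mul_const _ hw]
  gcongr
  have hsplit : ∀ t, (splitCoord i).symm (t, w)
      = (splitCoord i).symm (0, w) + EuclideanSpace.single i t := fun t => splitCoord_symm_add i t w
  rw [lintegral_congr fun t => congrArg L (hsplit t)]
  exact hline _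

theorem ae_lt_top_of_lintegral_line_le {M : ℕ} (i : Fin M) {L : E M → ENNReal} (hL : Measurable L)
    {C : ENNReal} (hC : C ≠ ⊤) (hline : ∀ c, ∫⁻ t, L (c + EuclideanSpace.single i t) ≤ C) :
    ∀ᵐ c, L c < ⊤ := by
  -- Line bounds alone do not make `L` integrable on the whole space; a strictly positive integrable
  -- weight in the other coordinates does.
  obtain ⟨q, hq0, hqm, hq⟩ := exists_pos_lintegral_lt_of_sigmaFinite
    (volume : Measure ({j : Fin M // j ≠ i} → ℝ)) one_ne_zero
  have h := lintegral_mul_removeCoord_le i hL hline (q := fun w => (q w : ENNReal))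
    hqm.coe_nnreal_ennreal.aemeasurable
  have hr : Measurable (removeCoord i : E M → _) := by
    unfold removeCoord; fun_prop
  have hfin := ae_lt_top (hL.mul (hqm.coe_nnreal_ennreal.comp hr))
    (h.trans_lt (ENNReal.mul_lt_top hC.lt_top (hq.trans ENNReal.one_lt_top))).ne
  filter_upwards [hfin] with c hc
  by_contra hcon
  have : L c = ⊤ := not_lt_top_iff.1 hcon
  simp [this, ENNReal.top_mul, (hq0 _).ne'] at hc

/-! ### The conjugate function and its curvature. -/

/-- The conjugate `c ↦ - min_x (ψ(x) + V(x, c))`, a convex function of `c`. -/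
noncomputable def dualValue {d M : ℕ} (F : Fin M → Torus d → ℝ) (ψ : Torus d → ℝ) (c : E M) : ℝ :=
  ⨆ x, -(ψ x + potential F x c)

/-- The symmetric second difference of the conjugate in the `i`-th coordinate. -/
noncomputable def dualSecondDiff {d M : ℕ} (F : Fin M → Torus d → ℝ) (ψ : Torus d → ℝ) (i : Fin M)
    (c : E M) (s : ℝ) : ℝ :=
  dualValue F ψ (c + EuclideanSpace.single i s) + dualValue F ψ (c + EuclideanSpace.single i (-s))
    - 2 * dualValue F ψ c

/-- The upper second derivative of the conjugate in the `i`-th coordinate, along dyadic steps. -/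
noncomputable def dualCurvature {d M : ℕ} (F : Fin M → Torus d → ℝ) (ψ : Torus d → ℝ) (i : Fin M)
    (c : E M) : ENNReal :=
  limsup (fun n : ℕ => ENNReal.ofReal (dualSecondDiff F ψ i c ((1 / 2) ^ n) / ((1 / 2) ^ n) ^ 2))
    atTop

/-- A positive majorant of the second derivatives of the conjugate in the `i`-th coordinate. -/
noncomputable def curvatureBound {d M : ℕ} (F : Fin M → Torus d → ℝ) (ψ : Torus d → ℝ) (i : Fin M)
    (c : E M) : ℝ :=
  (dualCurvature F ψ i c).toReal + (1 + c i ^ 2)⁻¹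

section

variable {d M : ℕ} {F : Fin M → Torus d → ℝ} {ψ : Torus d → ℝ}

theorem potential_add (x : Torus d) (c e : E M) :
    potential F x (c + e) = potential F x c + potential F x e := by
  simp [potential, add_mul, Finset.sum_add_distrib]
  ring

theorem potential_single (x : Torus d) (i : Fin M) (s : ℝ) :
    potential F x (EuclideanSpace.single i s) = -(s * F i x) := by
  simp [potential]

theorem continuous_potential (hF : ∀ i, Continuous (F i)) (c : E M) :
    Continuous fun x => potential F x c := by
  unfold potential
  fun_prop

theorem exists_minimizer (hF : ∀ i, Continuous (F i)) (hψ : Continuous ψ) (c : E M) :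
    ∃ x, ∀ y, ψ x + potential F x c ≤ ψ y + potential F y c := by
  obtain ⟨x, -, hx⟩ := isCompact_univ.exists_isMinOn Set.univ_nonempty
    (hψ.add (continuous_potential hF c)).continuousOn
  exact ⟨x, fun y => hx (Set.mem_univ y)⟩

theorem dualValue_eq {c : E M} {x : Torus d}
    (hx : ∀ y, ψ x + potential F x c ≤ ψ y + potential F y c) :
    dualValue F ψ c = -(ψ x + potential F x c) :=
  le_antisymm (ciSup_le fun y => neg_le_neg (hx y))
    (le_ciSup (f := fun y => -(ψ y + potential F y c))
      ⟨-(ψ x + potential F x c), by rintro _ ⟨y, rfl⟩; exact neg_le_neg (hx y)⟩ x)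

theorem le_dualValue (hF : ∀ i, Continuous (F i)) (hψ : Continuous ψ) (c : E M) (y : Torus d) :
    -(ψ y + potential F y c) ≤ dualValue F ψ c := by
  obtain ⟨x, hx⟩ := exists_minimizer hF hψ c
  rw [dualValue_eq hx]
  exact neg_le_neg (hx y)

/-- Minimizers provide subgradients of the conjugate. -/
theorem dualValue_sub_potential_le (hF : ∀ i, Continuous (F i)) (hψ : Continuous ψ) {c : E M}
    {x : Torus d} (hx : ∀ y, ψ x + potential F x c ≤ ψ y + potential F y c) (e : E M) :
    dualValue F ψ c - potential F x e ≤ dualValue F ψ (c + e) := by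
  have h := le_dualValue hF hψ (c + e) x
  rw [potential_add] at h
  rw [dualValue_eq hx]
  linarith

theorem abs_potential_le {B : ℝ} (hB : ∀ i x, |F i x| ≤ B) (x : Torus d) (e : E M) :
    |potential F x e| ≤ M * B * ‖e‖ := by
  rw [potential, abs_neg]
  calc |∑ i, e i * F i x| ≤ ∑ i, |e i * F i x| := Finset.abs_sum_le_sum_abs _ _
    _ ≤ ∑ _i : Fin M, ‖e‖ * B := by
        refine Finset.sum_le_sum fun i _ => ?_
        rw [abs_mul]
        gcongr
        · exact PiLp.norm_apply_le e i
        · exact hB i x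
    _ = M * B * ‖e‖ := by simp; ring

theorem continuous_dualValue (hF : ∀ i, Continuous (F i)) (hψ : Continuous ψ) {B : ℝ}
    (hB : ∀ i x, |F i x| ≤ B) : Continuous (dualValue F ψ) := by
  refine (LipschitzWith.of_le_add_mul' (M * B) fun c c' => ?_).continuous
  obtain ⟨x, hx⟩ := exists_minimizer hF hψ c
  have h := dualValue_sub_potential_le hF hψ hx (c' - c)
  rw [add_sub_cancel] at h
  have h2 := (abs_le.1 (abs_potential_le hB x (c' - c))).2
  rw [dist_comm, dist_eq_norm]
  linarith

/-- Restricting to dyadic steps makes this a countable limsup of continuous functions. -/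
theorem measurable_dualCurvature (hF : ∀ i, Continuous (F i)) (hψ : Continuous ψ) {B : ℝ}
    (hB : ∀ i x, |F i x| ≤ B) (i : Fin M) : Measurable (dualCurvature F ψ i) := by
  refine Measurable.limsup fun n => ENNReal.measurable_ofReal.comp ?_
  have hc := continuous_dualValue hF hψ hB
  have : Continuous fun c => dualSecondDiff F ψ i c ((1 / 2) ^ n) := by
    unfold dualSecondDiff
    fun_prop
  exact (this.div_const _).measurable

theorem lintegral_dualCurvature_line_le (hF : ∀ i, Continuous (F i)) (hψ : Continuous ψ) {B : ℝ}
    (hB : ∀ i x, |F i x| ≤ B) (i : Fin M) (c : E M) :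
    ∫⁻ t, dualCurvature F ψ i (c + EuclideanSpace.single i t) ≤ ENNReal.ofReal (4 * B) := by
  -- Any selection of minimizers will do: its values under `F i` are subgradients, hence
  -- automatically monotone along the line.
  choose x hx using exists_minimizer (M := M) hF hψ
  have hadd : ∀ t u : ℝ, c + EuclideanSpace.single i t + EuclideanSpace.single i u
      = c + EuclideanSpace.single i (t + u) := fun t u => by
    ext j
    by_cases h : j = i <;> simp [h, add_assoc]
  have h := lintegral_limsup_second_difference_le
    (φ := fun t => dualValue F ψ (c + EuclideanSpace.single i t))
    (r := fun t => F i (x (c + EuclideanSpace.single i t))) (B := B) (fun t t' => by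
      have h1 := dualValue_sub_potential_le hF hψ (hx (c + EuclideanSpace.single i t))
        (EuclideanSpace.single i (t' - t))
      rw [potential_single, hadd, add_sub_cancel] at h1
      linarith) (fun t => hB _ _) (s := fun n : ℕ => (1 / 2 : ℝ) ^ n) (fun n => by positivity)
    (tendsto_pow_atTop_nhds_zero_of_lt_one (by norm_num) (by norm_num))
  refine le_trans (le_of_eq (lintegral_congr fun t => ?_)) h
  simp only [dualCurvature, dualSecondDiff, hadd, sub_eq_add_neg]

theorem ae_dualCurvature_lt_top (hF : ∀ i, Continuous (F i)) (hψ : Continuous ψ) {B : ℝ}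
    (hB : ∀ i x, |F i x| ≤ B) : ∀ᵐ c : E M, ∀ i, dualCurvature F ψ i c < ⊤ :=
  ae_all_iff.2 fun i => ae_lt_top_of_lintegral_line_le i (measurable_dualCurvature hF hψ hB i)
    ENNReal.ofReal_ne_top (lintegral_dualCurvature_line_le hF hψ hB i)

/-- The summand (1 + cᵢ²)⁻¹ ensures positivity even where `toReal` returns 0, including where the
curvature is ⊤. -/
theorem curvatureBound_pos (i : Fin M) (c : E M) : 0 < curvatureBound F ψ i c := by
  unfold curvatureBound
  positivity

theorem measurable_curvatureBound (hF : ∀ i, Continuous (F i)) (hψ : Continuous ψ) {B : ℝ}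
    (hB : ∀ i x, |F i x| ≤ B) (i : Fin M) : Measurable (curvatureBound F ψ i) := by
  have := measurable_dualCurvature hF hψ hB i
  unfold curvatureBound
  fun_prop

/-- The positive summand leaves strict room above the limsup, so the bound holds for all large n. -/
theorem eventually_dualSecondDiff_le {i : Fin M} {c : E M} (h : dualCurvature F ψ i c < ⊤) :
    ∀ᶠ n : ℕ in atTop,
      dualSecondDiff F ψ i c ((1 / 2) ^ n) ≤ curvatureBound F ψ i c * ((1 / 2) ^ n) ^ 2 := by
  have hlt : dualCurvature F ψ i c < ENNReal.ofReal (curvatureBound F ψ i c) := by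
    rw [ENNReal.lt_ofReal_iff_toReal_lt h.ne, curvatureBound]
    have : 0 < (1 + c i ^ 2)⁻¹ := by positivity
    linarith
  filter_upwards [eventually_lt_of_limsup_lt hlt] with n hn
  have h1 := (ENNReal.ofReal_lt_ofReal_iff (curvatureBound_pos i c)).1 hn
  rw [div_lt_iff₀ (by positivity)] at h1
  exact h1.le

/-! ### Growth of H at minimizers. -/

/-- Test the supremum at c + s eᵢ with y and at c - s eᵢ with x. Evenness in s later supplies the
absolute value. -/
theorem mul_sub_dualSecondDiff_le (hF : ∀ i, Continuous (F i)) (hψ : Continuous ψ) {c : E M}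
    {x : Torus d} (hx : ∀ y, ψ x + potential F x c ≤ ψ y + potential F y c) (i : Fin M) (s : ℝ)
    (y : Torus d) :
    s * (F i y - F i x) - dualSecondDiff F ψ i c s
      ≤ ψ y + potential F y c - (ψ x + potential F x c) := by
  have h1 := le_dualValue hF hψ (c + EuclideanSpace.single i s) y
  have h2 := le_dualValue hF hψ (c + EuclideanSpace.single i (-s)) x
  rw [potential_add, potential_single] at h1 h2
  rw [dualSecondDiff, dualValue_eq hx]
  linarith

theorem mul_abs_sub_dualSecondDiff_le (hF : ∀ i, Continuous (F i)) (hψ : Continuous ψ) {c : E M}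
    {x : Torus d} (hx : ∀ y, ψ x + potential F x c ≤ ψ y + potential F y c) (i : Fin M) (s : ℝ)
    (y : Torus d) :
    s * |F i y - F i x| - dualSecondDiff F ψ i c s
      ≤ ψ y + potential F y c - (ψ x + potential F x c) := by
  have h1 := mul_sub_dualSecondDiff_le hF hψ hx i s y
  have h2 := mul_sub_dualSecondDiff_le hF hψ hx i (-s) y
  have h3 : dualSecondDiff F ψ i c (-s) = dualSecondDiff F ψ i c s := by
    simp only [dualSecondDiff, neg_neg]
    ring
  rw [h3] at h2
  rcases abs_cases (F i y - F i x) with h | h <;> rw [h.1] <;> linarith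

/-- An upper quadratic bound on the conjugate gives a lower quadratic bound at minimizers. -/
theorem exists_quadratic_growth (hF : ∀ i, Continuous (F i)) (hψ : Continuous ψ) {c : E M}
    {x : Torus d} (hx : ∀ y, ψ x + potential F x c ≤ ψ y + potential F y c) {i : Fin M} {K : ℝ}
    (hK : 0 < K)
    (hsd : ∀ᶠ n : ℕ in atTop, dualSecondDiff F ψ i c ((1 / 2) ^ n) ≤ K * ((1 / 2) ^ n) ^ 2) :
    ∃ δ > 0, ∀ y, |F i y - F i x| < δ →
      (F i y - F i x) ^ 2 / (8 * K) ≤ ψ y + potential F y c - (ψ x + potential F x c) := by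
  obtain ⟨N, hN⟩ := eventually_atTop.1 hsd
  refine ⟨2 * K * (1 / 2) ^ N, by positivity, fun y hy => ?_⟩
  set Δ := |F i y - F i x| with hΔ
  rw [← sq_abs, ← hΔ]
  rcases (abs_nonneg (F i y - F i x)).eq_or_lt with h0 | hpos
  · rw [← hΔ] at h0
    rw [← h0]
    have := hx y
    simpa using this
  · rw [← hΔ] at hpos
    have hq : Δ / (2 * K) < (1 / 2) ^ N := by
      rw [div_lt_iff₀ (by positivity)]
      linarith
    have hle1 : ((1 : ℝ) / 2) ^ N ≤ 1 := pow_le_one₀ (by norm_num) (by norm_num)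
    -- The maximizer of sΔ - K s² is Δ / (2K). With p = 2⁻ⁿ and p/2 < Δ / (2K) ≤ p, the dyadic step
    -- s = p/2 still yields sΔ - K s² ≥ pΔ/4 ≥ Δ² / (8K).
    obtain ⟨n, hn1, hn2⟩ := exists_nat_pow_near_of_lt_one (x := Δ / (2 * K)) (y := 1 / 2)
      (by positivity) (hq.le.trans hle1) (by norm_num) (by norm_num)
    have hNn : N ≤ n + 1 := by
      by_contra hcon
      have : ((1 : ℝ) / 2) ^ N ≤ (1 / 2) ^ (n + 1) :=
        pow_le_pow_of_le_one (by norm_num) (by norm_num) (by omega)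
      linarith
    have h1 := mul_abs_sub_dualSecondDiff_le hF hψ hx i ((1 / 2) ^ (n + 1)) y
    have h2 := hN (n + 1) hNn
    rw [pow_succ] at hn1 h1 h2
    rw [← hΔ] at h1
    set p := ((1 : ℝ) / 2) ^ n with hp
    rw [lt_div_iff₀ (by positivity)] at hn1
    rw [div_le_iff₀ (by positivity)] at hn2
    have hp0 : 0 < p := by positivity
    rw [div_le_iff₀ (by positivity)]
    have h3 : p * (1 / 2) * Δ - K * (p * (1 / 2)) ^ 2 ≤
      ψ y + potential F y c - (ψ x + potential F x c) := by linarith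
    have h4 : p * Δ / 4 ≤ p * (1 / 2) * Δ - K * (p * (1 / 2)) ^ 2 := by nlinarith
    have h5 : Δ ^ 2 ≤ 2 * K * p * Δ := by nlinarith
    nlinarith [mul_le_mul_of_nonneg_left (h4.trans h3) (by positivity : 0 ≤ 8 * K)]

/-- For small s the linear gain s |F i y - F i x| beats the loss K s². -/
theorem lt_of_apply_ne (hF : ∀ i, Continuous (F i)) (hψ : Continuous ψ) {c : E M}
    {x : Torus d} (hx : ∀ y, ψ x + potential F x c ≤ ψ y + potential F y c) {i : Fin M} {K : ℝ}
    (hsd : ∀ᶠ n : ℕ in atTop, dualSecondDiff F ψ i c ((1 / 2) ^ n) ≤ K * ((1 / 2) ^ n) ^ 2)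
    {y : Torus d} (hy : F i y ≠ F i x) : ψ x + potential F x c < ψ y + potential F y c := by
  have ht : Tendsto (fun n : ℕ => K * ((1 : ℝ) / 2) ^ n) atTop (𝓝 (K * 0)) :=
    (tendsto_pow_atTop_nhds_zero_of_lt_one (by norm_num) (by norm_num)).const_mul K
  rw [mul_zero] at ht
  obtain ⟨n, hn1, hn2⟩ :=
    (hsd.and (ht.eventually_lt_const (abs_pos.2 (sub_ne_zero.2 hy)))).exists
  have h1 := mul_abs_sub_dualSecondDiff_le hF hψ hx i ((1 / 2) ^ n) y
  have hp : (0 : ℝ) < (1 / 2) ^ n := by positivity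
  nlinarith [mul_lt_mul_of_pos_left hn2 hp]

/-! ### Integrating the curvature bound. -/

/-- On each line the curvature contributes 4B and (1 + t²)⁻¹ contributes π. -/
theorem lintegral_curvatureBound_mul_le (hF : ∀ i, Continuous (F i)) (hψ : Continuous ψ) {B : ℝ}
    (hB0 : 0 ≤ B) (hB : ∀ i x, |F i x| ≤ B) (i : Fin M)
    {q : ({j : Fin M // j ≠ i} → ℝ) → ENNReal} (hq : AEMeasurable q) :
    ∫⁻ c, ENNReal.ofReal (curvatureBound F ψ i c) * q (removeCoord i c)
      ≤ ENNReal.ofReal (4 * B + Real.pi) * ∫⁻ w, q w := by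
  have h1 := lintegral_mul_removeCoord_le i (measurable_dualCurvature hF hψ hB i)
    (lintegral_dualCurvature_line_le hF hψ hB i) hq
  have hm : Measurable fun c : E M => ENNReal.ofReal (1 + c i ^ 2)⁻¹ := by fun_prop
  have h2 := lintegral_mul_removeCoord_le i hm (C := ENNReal.ofReal (Real.pi)) (fun c => by
    have : ∀ t : ℝ, ENNReal.ofReal (1 + (c + EuclideanSpace.single i t) i ^ 2)⁻¹
        = ENNReal.ofReal (1 + (c i + t) ^ 2)⁻¹ := fun t => by simp
    rw [lintegral_congr this,
      lintegral_add_left_eq_self (fun t : ℝ => ENNReal.ofReal (1 + t ^ 2)⁻¹) (c i),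
      ← ofReal_integral_eq_lintegral_ofReal integrable_inv_one_add_sq
        (Eventually.of_forall fun t => by positivity), integral_univ_inv_one_add_sq]) hq
  rw [ENNReal.ofReal_add (by positivity) (by positivity), add_mul]
  refine le_trans ?_ (add_le_add h1 h2)
  have hr : MeasurePreserving (splitCoord i) := measurePreserving_splitCoord i
  have hqr : AEMeasurable fun c : E M => q (removeCoord i c) :=
    hq.comp_quasiMeasurePreserving
      (Measure.quasiMeasurePreserving_snd.comp hr.quasiMeasurePreserving)
  have hm2 : AEMeasurable fun c : E M => ENNReal.ofReal (1 + c i ^ 2)⁻¹ * q (removeCoord i c) :=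
    hm.aemeasurable.mul hqr
  rw [← lintegral_add_right' _ hm2]
  refine lintegral_mono fun c => ?_
  rw [← add_mul]
  gcongr
  rw [curvatureBound, ENNReal.ofReal_add ENNReal.toReal_nonneg (by positivity)]
  gcongr
  exact ENNReal.ofReal_toReal_le

/-- The integral of the curvature bound against a dominated density. -/
theorem lintegral_curvatureBound_mul_density_le (hF : ∀ i, Continuous (F i)) (hψ : Continuous ψ)
    {B : ℝ} (hB0 : 0 ≤ B) (hB : ∀ i x, |F i x| ≤ B) {ρ : E M → ℝ} {σ : Fin M → ℝ → ℝ}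
    {τ : (i : Fin M) → ({j : Fin M // j ≠ i} → ℝ) → ℝ} (hρ : IsDominatedDensity ρ σ τ)
    (i : Fin M) :
    ∫⁻ c, ENNReal.ofReal (curvatureBound F ψ i c * ρ c)
      ≤ ENNReal.ofReal ((4 * B + Real.pi) *
          ((eLpNorm (σ i) ⊤ volume).toReal * (eLpNorm (τ i) 1 volume).toReal)) := by
  have hr : MeasurePreserving (splitCoord i) := measurePreserving_splitCoord i
  set S := eLpNorm (σ i) ⊤ volume with hS
  have hStop : S ≠ ⊤ := (hρ.memLp_top i).2.ne
  have hTtop : eLpNorm (τ i) 1 volume ≠ ⊤ := (hρ.memLp_one i).2.ne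
  have hσ : ∀ᵐ t, ‖σ i t‖ₑ ≤ S := by
    rw [hS, eLpNorm_exponent_top]
    exact ae_le_eLpNormEssSup
  have hσ' : ∀ᵐ c : E M, ‖σ i (c i)‖ₑ ≤ S :=
    (Measure.quasiMeasurePreserving_fst.comp hr.quasiMeasurePreserving).ae hσ
  have hτ : AEMeasurable fun w => ‖τ i w‖ₑ := (hρ.memLp_one i).1.enorm
  have hle : ∀ᵐ c : E M, ENNReal.ofReal (curvatureBound F ψ i c * ρ c)
      ≤ ENNReal.ofReal (curvatureBound F ψ i c) * (S * ‖τ i (removeCoord i c)‖ₑ) := by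
    filter_upwards [hσ', hρ.le_mul i] with c h1 h2
    rw [ENNReal.ofReal_mul (curvatureBound_pos i c).le]
    gcongr
    -- Neither factor need be nonnegative, so the product is compared through its norm.
    calc ENNReal.ofReal (ρ c) ≤ ENNReal.ofReal (σ i (c i) * τ i (removeCoord i c)) :=
          ENNReal.ofReal_le_ofReal h2
      _ ≤ ‖σ i (c i) * τ i (removeCoord i c)‖ₑ := Real.ofReal_le_enorm _
      _ = ‖σ i (c i)‖ₑ * ‖τ i (removeCoord i c)‖ₑ := enorm_mul _ _
      _ ≤ S * ‖τ i (removeCoord i c)‖ₑ := by gcongr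
  calc _ ≤ _ := lintegral_mono_ae hle
    _ ≤ ENNReal.ofReal (4 * B + Real.pi) * ∫⁻ w, S * ‖τ i w‖ₑ :=
        lintegral_curvatureBound_mul_le hF hψ hB0 hB i (q := fun w => S * ‖τ i w‖ₑ)
          (hτ.const_mul S)
    _ = ENNReal.ofReal (4 * B + Real.pi) * (S * eLpNorm (τ i) 1 volume) := by
        rw [lintegral_const_mul'' _ hτ, eLpNorm_one_eq_lintegral_enorm]
    _ = _ := by
        rw [ENNReal.ofReal_mul (by positivity), ENNReal.ofReal_mul ENNReal.toReal_nonneg,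
          ENNReal.ofReal_toReal hStop, ENNReal.ofReal_toReal hTtop]

end

/-! ### Immersion, differentiability and the second subderivative. -/

section

variable {d M : ℕ} {F : Fin M → Torus d → ℝ} {ψ : Torus d → ℝ}

theorem IsTorusEmbedding.neg {Φ : Torus d → E M} (h : IsTorusEmbedding Φ) :
    IsTorusEmbedding fun x => -Φ x where
  contDiff := h.contDiff.neg
  isEmbedding := (Homeomorph.neg (E M)).isEmbedding.comp h.isEmbedding
  immersion x := by
    rw [fderiv_fun_neg]
    exact neg_injective.comp (h.immersion x)

theorem IsTorusEmbedding.le_dim {Φ : Torus d → E M} (h : IsTorusEmbedding Φ) : d ≤ M := by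
  have := LinearMap.finrank_le_finrank_of_injective
    (f := (fderiv ℝ (fun y : E d => Φ (toTorus y)) 0).toLinearMap) (h.immersion 0)
  simpa using this

/-- Compactness of cube × unit sphere gives a positive minimum of |DΦ v|²; homogeneity extends it to
all v. -/
theorem IsTorusEmbedding.exists_le_norm_fderiv {Φ : Torus d → E M} (h : IsTorusEmbedding Φ) :
    ∃ κ > 0, ∀ z ∈ unitCube d, ∀ v : E d,
      κ * ‖v‖ ^ 2 ≤ ‖fderiv ℝ (fun y : E d => Φ (toTorus y)) z v‖ ^ 2 := by
  set D := fun z : E d => fderiv ℝ (fun y : E d => Φ (toTorus y)) z with hD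
  have hcont : Continuous fun p : E d × E d => ‖D p.1 p.2‖ ^ 2 :=
    ((h.contDiff.continuous_fderiv_apply (by norm_num)).norm).pow 2
  have hcomp : IsCompact (unitCube d ×ˢ Metric.sphere (0 : E d) 1) :=
    (isCompact_unitCube d).prod (isCompact_sphere 0 1)
  obtain ⟨κ, hκ, hmin⟩ : ∃ κ > 0, ∀ z ∈ unitCube d, ∀ v ∈ Metric.sphere (0 : E d) 1,
      κ ≤ ‖D z v‖ ^ 2 := by
    rcases (unitCube d ×ˢ Metric.sphere (0 : E d) 1).eq_empty_or_nonempty with he | hne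
    · exact ⟨1, one_pos, fun z hz v hv => absurd (Set.mk_mem_prod hz hv) (by simp [he])⟩
    · obtain ⟨p, hp, hpmin⟩ := hcomp.exists_isMinOn hne hcont.continuousOn
      refine ⟨‖D p.1 p.2‖ ^ 2, ?_, fun z hz v hv =>
        isMinOn_iff.1 hpmin (z, v) (Set.mk_mem_prod hz hv)⟩
      have hp2 : p.2 ≠ 0 := ne_zero_of_mem_unit_sphere ⟨p.2, hp.2⟩
      have : D p.1 p.2 ≠ 0 := fun h0 => hp2 (h.immersion p.1 (h0.trans (map_zero _).symm))
      positivity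
  refine ⟨κ, hκ, fun z hz v => ?_⟩
  rcases eq_or_ne v 0 with rfl | hv
  · simp
  · have hv0 : 0 < ‖v‖ := norm_pos_iff.2 hv
    have h1 := hmin z hz (‖v‖⁻¹ • v) (by simp [norm_smul, hv0.ne'])
    rw [map_smul, norm_smul, norm_inv, norm_norm, mul_pow, inv_pow, ← div_eq_inv_mul,
      le_div_iff₀ (by positivity)] at h1
    exact h1

theorem hasFDerivAt_comp_add_toTorus {Φ : Torus d → E M} (h : IsTorusEmbedding Φ) (z : E d) :
    HasFDerivAt (fun v : E d => Φ (toTorus z + toTorus v))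
      (fderiv ℝ (fun y : E d => Φ (toTorus y)) z) 0 := by
  have h1 : HasFDerivAt (fun y : E d => Φ (toTorus y))
      (fderiv ℝ (fun y : E d => Φ (toTorus y)) z) (z + 0) := by
    rw [add_zero]
    exact (h.contDiff.differentiable (by norm_num) z).hasFDerivAt
  simpa only [toTorus_add] using (hasFDerivAt_comp_add_left z).2 h1

theorem potential_eq_inner (x : Torus d) (c : E M) :
    potential F x c = inner ℝ (-tupleMap F x) c := by
  simp [potential, tupleMap, PiLp.inner_apply]

theorem gradient_potential (x : Torus d) (c : E M) :
    gradient (potential F x) c = -tupleMap F x := by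
  refine HasGradientAt.gradient ?_
  rw [hasGradientAt_iff_hasFDerivAt]
  have : potential F x = fun c => InnerProductSpace.toDual ℝ (E M) (-tupleMap F x) c := by
    ext c
    rw [potential_eq_inner, InnerProductSpace.toDual_apply_apply]
  rw [this]
  exact ContinuousLinearMap.hasFDerivAt _

theorem contDiff_potential (hF : IsTorusEmbedding (tupleMap F)) :
    ContDiff ℝ 2 fun p : E d × E M => potential F (toTorus p.1) p.2 := by
  simp only [potential_eq_inner]
  exact ((hF.contDiff.comp contDiff_fst).neg).inner ℝ contDiff_snd

/-- At a minimizer, a function bounded above by a differentiable function is differentiable with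
zero derivative. -/
theorem hasFDerivAt_zero_of_le {f u : E d → ℝ} (hf : ∀ v, f 0 ≤ f v) (hfu : ∀ v, f v ≤ u v)
    (h0 : u 0 = f 0) (hu : DifferentiableAt ℝ u 0) : HasFDerivAt f (0 : E d →L[ℝ] ℝ) 0 := by
  have hmin : IsLocalMin u 0 := Eventually.of_forall fun v => by
    rw [h0]; exact (hf v).trans (hfu v)
  have hd := hu.hasFDerivAt
  rw [hmin.fderiv_eq_zero, hasFDerivAt_iff_isLittleO_nhds_zero] at hd
  rw [hasFDerivAt_iff_isLittleO_nhds_zero]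
  refine (Asymptotics.IsBigO.of_bound 1 (Eventually.of_forall fun v => ?_)).trans_isLittleO hd
  have h1 := hf v
  have h2 := hfu v
  simp only [zero_add, zero_apply, sub_zero, h0, Real.norm_eq_abs, one_mul]
  rw [abs_of_nonneg (by linarith), abs_of_nonneg (by linarith)]
  linarith

/-- Semi-concavity supplies a differentiable majorant touching H(·, c) at the minimizer, while
minimality bounds H from below by a constant. -/
theorem hasFDerivAt_minimizer (hF : IsTorusEmbedding (tupleMap F)) (hψ : SemiConcave ψ) {c : E M}
    {x : Torus d} (hx : ∀ y, ψ x + potential F x c ≤ ψ y + potential F y c) :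
    HasFDerivAt (fun v : E d => ψ (x + toTorus v) + potential F (x + toTorus v) c)
      (0 : E d →L[ℝ] ℝ) 0 := by
  obtain ⟨C, hC⟩ := hψ
  obtain ⟨l, hl⟩ := hC x
  obtain ⟨z, -, rfl⟩ := exists_mem_unitCube x
  refine hasFDerivAt_zero_of_le
    (u := fun v => ψ (toTorus z) + (l v + C / 2 * ‖v‖ ^ 2) + potential F (toTorus z + toTorus v) c)
    (fun v => ?_) (fun v => ?_) ?_ ?_
  · simpa [toTorus_zero] using hx (toTorus z + toTorus v)
  · have := hl v
    linarith
  · simp [toTorus_zero]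
  · have h1 : DifferentiableAt ℝ (fun v : E d => potential F (toTorus z + toTorus v) c) 0 := by
      simp only [potential_eq_inner]
      exact ((hasFDerivAt_comp_add_toTorus hF z).differentiableAt.neg).inner ℝ
        (differentiableAt_const c)
    have h2 : DifferentiableAt ℝ (fun v : E d => ‖v‖ ^ 2) 0 :=
      (contDiff_norm_sq ℝ (n := 1)).differentiable one_ne_zero 0
    fun_prop

theorem le_secondSubderiv_minimizer (hF : IsTorusEmbedding (tupleMap F)) (hψ : SemiConcave ψ)
    (hM : 0 < M) {κ : ℝ} (hκ : ∀ z ∈ unitCube d, ∀ v : E d,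
      κ * ‖v‖ ^ 2 ≤ ‖fderiv ℝ (fun y : E d => tupleMap F (toTorus y)) z v‖ ^ 2)
    {c : E M} {x : Torus d} (hx : ∀ y, ψ x + potential F x c ≤ ψ y + potential F y c)
    {K : Fin M → ℝ} (hK : ∀ i, 0 < K i)
    (hgrowth : ∀ i, ∃ δ > 0, ∀ y, |F i y - F i x| < δ →
      (F i y - F i x) ^ 2 / (8 * K i) ≤ ψ y + potential F y c - (ψ x + potential F x c))
    (w : E d) :
    ((κ / (4 * M * ∑ i, K i) * ‖w‖ ^ 2 : ℝ) : EReal)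
      ≤ secondSubderiv (fun y => ψ y + potential F y c) x w := by
  have hderiv : torusDeriv (fun y => ψ y + potential F y c) x = 0 :=
    (hasFDerivAt_minimizer hF hψ hx).fderiv
  have hMR : (0 : ℝ) < M := by exact_mod_cast hM
  have hKsum : 0 < ∑ i, K i :=
    Finset.sum_pos (fun i _ => hK i) ⟨⟨0, hM⟩, Finset.mem_univ _⟩
  obtain ⟨z, hz, rfl⟩ := exists_mem_unitCube x
  set f := fun y => ψ y + potential F y c with hf
  -- Summing the growth bounds gives |F(y) - F(x)|² ≤ 8 M (∑ Kᵢ)(f(y) - f(x)); dividing by τ²/2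
  -- turns 8 into 4.
  set R : ℝ → ℝ := fun τ => (4 * M * ∑ i, K i)⁻¹ *
    ‖τ⁻¹ • (tupleMap F (toTorus z + toTorus (τ • w)) - tupleMap F (toTorus z))‖ ^ 2 with hR
  have hlim : Tendsto R (𝓝[>] 0) (𝓝 ((4 * M * ∑ i, K i)⁻¹ *
      ‖fderiv ℝ (fun y : E d => tupleMap F (toTorus y)) z w‖ ^ 2)) := by
    have h1 := ((hasFDerivAt_comp_add_toTorus hF z).hasLineDerivAt w).tendsto_slope_zero_right
    simp only [zero_add, toTorus_zero, add_zero] at h1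
    exact (h1.norm.pow 2).const_mul _
  have hFi : ∀ i, Continuous (F i) := fun i =>
    (EuclideanSpace.proj i : E M →L[ℝ] ℝ).continuous.comp hF.isEmbedding.continuous
  have hev : ∀ᶠ τ in 𝓝[>] (0 : ℝ), R τ ≤ (f (toTorus z + toTorus (τ • w)) - f (toTorus z)
      - torusDeriv f (toTorus z) (τ • w)) / (1 / 2 * τ ^ 2) := by
    have hclose : ∀ i, ∀ᶠ τ in 𝓝[>] (0 : ℝ),
        (F i (toTorus z + toTorus (τ • w)) - F i (toTorus z)) ^ 2 / (8 * K i) ≤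
          f (toTorus z + toTorus (τ • w)) - f (toTorus z) := fun i => by
      obtain ⟨δ, hδ, hg⟩ := hgrowth i
      have hcont : Continuous fun τ : ℝ =>
          |F i (toTorus z + toTorus (τ • w)) - F i (toTorus z)| := by
        have := hFi i
        have := continuous_toTorus (d := d)
        fun_prop
      have ht := hcont.tendsto 0
      simp only [zero_smul, toTorus_zero, add_zero, sub_self, abs_zero] at ht
      filter_upwards [(ht.mono_left nhdsWithin_le_nhds).eventually_lt_const hδ] with τ hτ
      exact hg _ hτ
    filter_upwards [eventually_all.2 hclose, self_mem_nhdsWithin] with τ hτ hτ0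
    have hτ0 : 0 < τ := hτ0
    rw [hderiv, zero_apply, sub_zero, le_div_iff₀ (by positivity)]
    have hsum : ∑ i, (F i (toTorus z + toTorus (τ • w)) - F i (toTorus z)) ^ 2 ≤
        M * (8 * (∑ i, K i) * (f (toTorus z + toTorus (τ • w)) - f (toTorus z))) := by
      have hle : ∀ i ∈ Finset.univ, (F i (toTorus z + toTorus (τ • w)) - F i (toTorus z)) ^ 2 ≤
          8 * (∑ i, K i) * (f (toTorus z + toTorus (τ • w)) - f (toTorus z)) := fun i _ => by
        have h1 := hτ i
        have hi := hK i
        rw [div_le_iff₀ (by positivity)] at h1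
        have h2 : K i ≤ ∑ i, K i :=
          Finset.single_le_sum (fun j _ => (hK j).le) (Finset.mem_univ i)
        have h3 : 0 ≤ f (toTorus z + toTorus (τ • w)) - f (toTorus z) :=
          sub_nonneg.2 (hx _)
        nlinarith [mul_le_mul_of_nonneg_right h2 h3]
      simpa using Finset.sum_le_sum hle
    have hnorm : ‖τ⁻¹ • (tupleMap F (toTorus z + toTorus (τ • w)) - tupleMap F (toTorus z))‖ ^ 2
        = (τ ^ 2)⁻¹ * ∑ i, (F i (toTorus z + toTorus (τ • w)) - F i (toTorus z)) ^ 2 := by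
      rw [norm_smul, mul_pow, EuclideanSpace.real_norm_sq_eq]
      simp [tupleMap]
    simp only [hR, hnorm]
    have hne : ∑ i, K i ≠ 0 := hKsum.ne'
    have e : (4 * M * ∑ i, K i)⁻¹ * ((τ ^ 2)⁻¹ *
        ∑ i, (F i (toTorus z + toTorus (τ • w)) - F i (toTorus z)) ^ 2) * (1 / 2 * τ ^ 2)
        = (∑ i, (F i (toTorus z + toTorus (τ • w)) - F i (toTorus z)) ^ 2) /
          (M * (8 * ∑ i, K i)) := by
      field_simp
      ring
    rw [e, div_le_iff₀ (by positivity)]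
    linarith
  have hlim' := (continuous_coe_real_ereal.tendsto _).comp hlim
  calc ((κ / (4 * M * ∑ i, K i) * ‖w‖ ^ 2 : ℝ) : EReal)
      ≤ (((4 * M * ∑ i, K i)⁻¹ *
        ‖fderiv ℝ (fun y : E d => tupleMap F (toTorus y)) z w‖ ^ 2 : ℝ) : EReal) := by
        rw [EReal.coe_le_coe_iff, div_mul_eq_mul_div, div_eq_inv_mul]
        gcongr
        exact hκ z hz w
    _ = liminf (fun τ => ((R τ : ℝ) : EReal)) (𝓝[>] 0) := hlim'.liminf_eq.symm
    _ ≤ _ := liminf_le_liminf (hev.mono fun τ hτ => EReal.coe_le_coe_iff.2 hτ)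

theorem integrable_and_integral_le_of_lintegral_ofReal_le {α : Type*} [MeasurableSpace α]
    {μ : Measure α} {f : α → ℝ} (hf : AEStronglyMeasurable f μ) (h0 : ∀ x, 0 ≤ f x) {b : ℝ}
    (hb : 0 ≤ b) (h : ∫⁻ x, ENNReal.ofReal (f x) ∂μ ≤ ENNReal.ofReal b) :
    Integrable f μ ∧ ∫ x, f x ∂μ ≤ b := by
  refine ⟨⟨hf, ?_⟩, ?_⟩
  · rw [hasFiniteIntegral_iff_ofReal (Eventually.of_forall h0)]
    exact h.trans_lt ENNReal.ofReal_lt_top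
  · rw [integral_eq_lintegral_of_nonneg_ae (Eventually.of_forall h0) hf]
    exact ENNReal.toReal_le_of_le_ofReal hb h

end

/-! ### Assembly. -/

theorem mainTheorem4 (d M : ℕ) (hd : 1 ≤ d) (F : Fin M → Torus d → ℝ)
    (hF : IsTorusEmbedding (tupleMap F)) :
    ContDiff ℝ 2 (fun p : E d × E M => potential F (toTorus p.1) p.2) ∧
    (∀ c : E M, IsTorusEmbedding (fun x : Torus d => gradient (potential F x) c)) ∧
    ∃ A : ℝ, ∀ ψ : Torus d → ℝ, SemiConcave ψ →
      ∃ a : E M → ℝ, Measurable a ∧ (∀ c, 0 < a c) ∧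
        HasNondegenerateMin (fun x c => ψ x + potential F x c) a ∧
        ∀ (ρ : E M → ℝ) (σ : Fin M → ℝ → ℝ)
          (τ : (i : Fin M) → ({j : Fin M // j ≠ i} → ℝ) → ℝ),
          IsDominatedDensity ρ σ τ →
          Integrable (fun c => (a c)⁻¹ * ρ c) ∧
          ∫ c, (a c)⁻¹ * ρ c < A * dominationBound σ τ := by
  refine ⟨contDiff_potential hF, fun c => by simpa only [gradient_potential] using hF.neg, ?_⟩
  have hM : 0 < M := hd.trans hF.le_dim
  have hMR : (0 : ℝ) < M := by exact_mod_cast hM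
  obtain ⟨κ, hκ0, hκ⟩ := hF.exists_le_norm_fderiv
  have hFi : ∀ i, Continuous (F i) := fun i =>
    (EuclideanSpace.proj i : E M →L[ℝ] ℝ).continuous.comp hF.isEmbedding.continuous
  obtain ⟨B, hB⟩ : ∃ B, ∀ i x, |F i x| ≤ B := by
    obtain ⟨B, hB⟩ := isCompact_univ.exists_bound_of_continuousOn
      hF.isEmbedding.continuous.continuousOn
    exact ⟨B, fun i x => (PiLp.norm_apply_le (tupleMap F x) i).trans (hB x (Set.mem_univ x))⟩
  have hB0 : 0 ≤ B := (abs_nonneg _).trans (hB ⟨0, hM⟩ 0)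
  -- The extra 1 makes the final inequality strict, since `dominationBound` is positive: otherwise
  -- a⁻¹ρ would have integral 0, forcing ρ = 0 a.e. against total mass 1.
  refine ⟨4 * M / κ * (4 * B + Real.pi) + 1, fun ψ hψ => ?_⟩
  have hψc := hψ.continuous
  set K : E M → ℝ := fun c => ∑ i, curvatureBound F ψ i c with hKdef
  have hK0 : ∀ c, 0 < K c := fun c =>
    Finset.sum_pos (fun i _ => curvatureBound_pos i c) ⟨⟨0, hM⟩, Finset.mem_univ _⟩
  have hKm : ∀ i, Measurable (curvatureBound F ψ i) := measurable_curvatureBound hFi hψc hB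
  refine ⟨fun c => κ / (4 * M * K c), ?_, fun c => ?_, ?_, fun ρ σ τ hρ => ?_⟩
  · have : Measurable K := Finset.measurable_fun_sum _ fun i _ => hKm i
    fun_prop
  · have := hK0 c
    positivity
  · filter_upwards [ae_dualCurvature_lt_top hFi hψc hB] with c hc
    obtain ⟨x, hx⟩ := exists_minimizer hFi hψc c
    refine ⟨x, fun y hy => ?_, (hasFDerivAt_minimizer hF hψ hx).differentiableAt, fun v => ?_⟩
    · have hne : ∃ i, F i y ≠ F i x := by
        by_contra! hcon
        exact hy (hF.isEmbedding.injective (by ext i; exact hcon i))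
      obtain ⟨i, hi⟩ := hne
      exact lt_of_apply_ne hFi hψc hx (eventually_dualSecondDiff_le (hc i)) hi
    · exact le_secondSubderiv_minimizer hF hψ hM hκ hx (fun i => curvatureBound_pos i c)
        (fun i => exists_quadratic_growth hFi hψc hx (curvatureBound_pos i c)
          (eventually_dualSecondDiff_le (hc i))) v
  · have hi : ∀ i, Integrable (fun c => curvatureBound F ψ i c * ρ c) ∧
        ∫ c, curvatureBound F ψ i c * ρ c ≤ (4 * B + Real.pi) *
          ((eLpNorm (σ i) ⊤ volume).toReal * (eLpNorm (τ i) 1 volume).toReal) := fun i =>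
      integrable_and_integral_le_of_lintegral_ofReal_le
        ((hKm i).aestronglyMeasurable.mul hρ.integrable.1)
        (fun c => mul_nonneg (curvatureBound_pos i c).le (hρ.nonneg c))
        (by positivity) (lintegral_curvatureBound_mul_density_le hFi hψc hB0 hB hρ i)
    have heq : (fun c => (κ / (4 * M * K c))⁻¹ * ρ c)
        = fun c => 4 * M / κ * ∑ i, curvatureBound F ψ i c * ρ c := by
      ext c
      rw [← Finset.sum_mul, inv_div]
      ring
    have hint : Integrable (fun c => (κ / (4 * M * K c))⁻¹ * ρ c) := by
      rw [heq]
      exact (integrable_finsetSum _ fun i _ => (hi i).1).const_mul _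
    have hle : ∫ c, (κ / (4 * M * K c))⁻¹ * ρ c
        ≤ 4 * M / κ * (4 * B + Real.pi) * dominationBound σ τ := by
      rw [heq, integral_const_mul, integral_finsetSum _ fun i _ => (hi i).1,
        mul_assoc (4 * M / κ)]
      refine mul_le_mul_of_nonneg_left ?_ (by positivity)
      rw [dominationBound, Finset.mul_sum]
      exact Finset.sum_le_sum fun i _ => (hi i).2
    refine ⟨hint, hle.trans_lt ?_⟩
    have hnonneg : ∀ c, 0 ≤ (κ / (4 * M * K c))⁻¹ * ρ c := fun c => by
      have h1 := hK0 c
      have h2 := hρ.nonneg c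
      positivity
    have hpos : 0 < dominationBound σ τ := by
      have h0 : 0 ≤ dominationBound σ τ := Finset.sum_nonneg fun i _ => by positivity
      refine h0.lt_of_ne fun hcon => ?_
      rw [← hcon, mul_zero] at hle
      have hzero := (integral_eq_zero_iff_of_nonneg hnonneg hint).1
        (le_antisymm hle (integral_nonneg hnonneg))
      have hρ0 : ρ =ᵐ[volume] 0 := by
        filter_upwards [hzero] with c hc
        have h1 := hK0 c
        exact (mul_eq_zero.1 hc).resolve_left (by positivity)
      have h1 := hρ.integral_eq_one
      rw [integral_congr_ae hρ0] at h1
      simp at h1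
    linarith
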